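/- Let $q$ be an indeterminate. For $k\ge 0$ write $(a;q)_k=\prod_{i=0}^{k-1}(1-aq^i)$ and $[k]_q=1+q+\cdots+q^{k-1}$; for $0\le r\le k$ let ${k\brack r}_q=\frac{(q;q)_k}{(q;q)_r(q;q)_{k-r}}$. Let $\Phi_N(q)$ denote the $N$-th cyclotomic polynomial and $\left(\frac{\cdot}{\cdot}\right)$ the Jacobi symbol. A congruence $f\equiv 0\pmod{P(q)}$ for a rational function $f\in\mathbb{Q}(q)$ and a polynomial $P\in\mathbb{Q}[q]$ means that, when $f$ is written in lowest terms, its numerator is divisible by $P$ and its denominator is relatively prime to $P$. **Theorem.** Let $m$ and $n$ be positive odd integers with $n>1$. Then $$ \frac{1}{[m]_{q^n}^2{m-1\brack (m-1)/2}_{q^n}}\Bigg(\sum_{k=0}^{(mn-1)/2}\frac{(q;q^2)_k (-1;q^4)_k}{(-q;q^2)_k(q^4;q^4)_k}q^{2k} -\left(\frac{2}{n}\right)\sum_{k=0}^{(m-1)/2}\frac{(q^n;q^{2n})_k (-1;q^{4n})_k}{(-q^n;q^{2n})_k(q^{4n};q^{4n})_k}q^{2nk}\Bigg)\equiv 0\pmod{\Phi_n(q)^2}.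 $$ Moreover, the denominator of the reduced form of the left-hand side is relatively prime to $\Phi_{n^j}(q)$ for every integer $j\ge 2$. -/

import Mathlib

/-- The `q`-shifted factorial `(a; q)_k = (1 - a) (1 - a q) ⋯ (1 - a q ^ (k - 1))`. -/
def qShiftedFactorial {R : Type*} [CommRing R] (a q : R) (k : ℕ) : R :=
  ∏ i ∈ Finset.range k, (1 - a * q ^ i)

/-- The `q`-integer `[n]_q = 1 + q + ⋯ + q ^ (n - 1)`. -/
def qInteger {R : Type*} [CommRing R] (q : R) (n : ℕ) : R :=
  ∑ i ∈ Finset.range n, q ^ i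

/-- The Gaussian binomial coefficient
`(q; q)_m / ((q; q)_n (q; q)_(m - n))` if `0 ≤ n ≤ m`, and `0` otherwise, for an element `q`
of a field that is not a root of unity. -/
def qBinomial {K : Type*} [Field K] (q : K) (m n : ℕ) : K :=
  if n ≤ m then
    qShiftedFactorial q q m / (qShiftedFactorial q q n * qShiftedFactorial q q (m - n))
  else 0

/-- The truncated sum
`∑_{k=0}^{N} (q; q²)_k (-1; q⁴)_k / ((-q; q²)_k (q⁴; q⁴)_k) * q^(2k)`. -/
def qSum {K : Type*} [Field K] (q : K) (N : ℕ) : K :=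
  ∑ k ∈ Finset.range (N + 1),
    qShiftedFactorial q (q ^ 2) k * qShiftedFactorial (-1) (q ^ 4) k /
      (qShiftedFactorial (-q) (q ^ 2) k * qShiftedFactorial (q ^ 4) (q ^ 4) k) * q ^ (2 * k)

/-- Congruence `f ≡ g (mod P)` of rational functions modulo a polynomial `P`: in lowest terms,
`f - g` has numerator divisible by `P` and denominator relatively prime to `P`. -/
def RatFuncModEq {K : Type*} [Field K] (P : Polynomial K) (f g : RatFunc K) : Prop :=
  P ∣ (f - g).num ∧ IsCoprime (f - g).denom P

/-- The quotient
`(S_q((mn - 1)/2) - (2/n) S_{q^n}((m - 1)/2)) / ([m]_{q^n}² * [m - 1 choose (m - 1)/2]_{q^n})`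
in the field `ℚ(q)`, where `S` is the sum `qSum`, `(2/n)` is the Jacobi symbol, and `q` is the
indeterminate `RatFunc.X`. -/
noncomputable def sunQuotient (m n : ℕ) : RatFunc ℚ :=
  (1 / (qInteger ((RatFunc.X : RatFunc ℚ) ^ n) m ^ 2 *
      qBinomial ((RatFunc.X : RatFunc ℚ) ^ n) (m - 1) ((m - 1) / 2))) *
    (qSum (RatFunc.X : RatFunc ℚ) ((m * n - 1) / 2) -
      (jacobiSym 2 n : RatFunc ℚ) * qSum ((RatFunc.X : RatFunc ℚ) ^ n) ((m - 1) / 2))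

open Finset

/-! ### The deformed sum and its exact values -/

section Identity

variable {K : Type*} [Field K]

/-! Replace `(q;q²)_i²` by `(aq;q²)_i (q/a;q²)_i`, so that the sum becomes a polynomial in `a + a⁻¹`
with value `qSum` at `a = 1`. At `a = q^(2N+1)` it equals the Jacobi symbol `(2/(2N+1))`
(`sum_qWeight_mul_symFactorial`). With `m = 2r+1`, multiplicativity of the symbol makes the deformed
difference vanish at the `r+1` nodes `a = q^((2j+1)n)`. In the variable `a + a⁻¹` each node is
congruent to `2` modulo `Φ_n²`, while the coefficients have denominator at most `Φ_n^(2r)`. Hence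
the difference at `a = 1` is divisible by `Φ_n²` (`IsQLocal.qSum_sub_div_sq_mem`), and the prefactor
is integral at `Φ_n`. At `Φ_(nN)`, both sums are compared with the sum in `q^(nN)`, and the
resulting divisibility absorbs the poles of the prefactor (`IsQLocal.quotient_mem`). -/

theorem qShiftedFactorial_succ {R : Type*} [CommRing R] (a q : R) (k : ℕ) :
    qShiftedFactorial a q (k + 1) = qShiftedFactorial a q k * (1 - a * q ^ k) :=
  prod_range_succ _ _

@[simp] theorem qShiftedFactorial_zero {R : Type*} [CommRing R] (a q : R) :
    qShiftedFactorial a q 0 = 1 :=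
  prod_range_zero _

theorem qShiftedFactorial_self_ne_zero {q : K} (hq : ∀ i, 0 < i → q ^ i ≠ 1) (k : ℕ) :
    qShiftedFactorial q q k ≠ 0 := by
  refine prod_ne_zero_iff.2 fun i _ => ?_
  rw [← pow_succ']
  exact sub_ne_zero.2 (hq _ i.succ_pos).symm

/-- The `a`-independent factor of the `k`-th summand of the deformed sum. -/
def qWeight (q : K) (k : ℕ) : K :=
  qShiftedFactorial (-1) (q ^ 4) k * q ^ (2 * k) / qShiftedFactorial (q ^ 2) (q ^ 2) (2 * k)

/-- The symmetric product `(aq; q²)_k (q/a; q²)_k`. -/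
def symFactorial (q a : K) (k : ℕ) : K :=
  ∏ i ∈ range k, ((1 - a * q ^ (2 * i + 1)) * (1 - q ^ (2 * i + 1) / a))

theorem symFactorial_succ (q a : K) (k : ℕ) :
    symFactorial q a (k + 1) =
      symFactorial q a k * ((1 - a * q ^ (2 * k + 1)) * (1 - q ^ (2 * k + 1) / a)) :=
  prod_range_succ _ _

@[simp] theorem symFactorial_zero (q a : K) : symFactorial q a 0 = 1 :=
  prod_range_zero _

theorem symFactorial_inv (q a : K) (k : ℕ) : symFactorial q a⁻¹ k = symFactorial q a k := by
  refine prod_congr rfl fun i _ => ?_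
  rw [div_inv_eq_mul, div_eq_mul_inv]
  ring

theorem symFactorial_one (q : K) (k : ℕ) :
    symFactorial q 1 k = qShiftedFactorial q (q ^ 2) k ^ 2 := by
  rw [symFactorial, qShiftedFactorial, ← prod_pow]
  refine prod_congr rfl fun i _ => ?_
  rw [div_one, ← pow_mul]
  ring

/-- Shifting `a` by `q²` changes the products only at their ends; the lower ends combine to `(1 -
aq)/(1 - 1/(aq)) = -aq`. -/
theorem symFactorial_succ_eq_shift {q a : K} (hq : q ≠ 0) (ha : a ≠ 0) (k : ℕ) :
    q * a * symFactorial q a (k + 1) =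
      -((q * a - q ^ (2 * k)) * (q * a - q ^ (2 * k + 2))) * symFactorial q (a * q ^ 2) k := by
  induction k with
  | zero =>
    simp only [symFactorial_succ, symFactorial_zero]
    field_simp
    ring
  | succ k ih =>
    rw [symFactorial_succ, ← mul_assoc, ih, symFactorial_succ]
    field_simp
    ring

theorem symFactorial_succ_eq_shift' {q a : K} (hq : q ≠ 0) (ha : a ≠ 0) (k : ℕ) :
    q ^ 3 * a * symFactorial q (a * q ^ 4) (k + 1) =
      -((1 - a * q ^ (2 * k + 3)) * (1 - a * q ^ (2 * k + 5))) *
        symFactorial q (a * q ^ 2) k := by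
  have h := symFactorial_succ_eq_shift hq (inv_ne_zero (mul_ne_zero ha (pow_ne_zero 4 hq))) k
  have e : (a * q ^ 4)⁻¹ * q ^ 2 = (a * q ^ 2)⁻¹ := by field_simp
  rw [e, symFactorial_inv, symFactorial_inv] at h
  generalize symFactorial q (a * q ^ 4) (k + 1) = A at *
  generalize symFactorial q (a * q ^ 2) k = B at *
  field_simp at h
  linear_combination h

/-- Both shift lemmas reduce the new term to the midpoint `aq²`, so the sum telescopes by a rational
identity in `q`, `a` and `q^(2k)`. -/
theorem sum_qWeight_mul_symFactorial_add {q a : K} (hq0 : q ≠ 0) (ha : a ≠ 0)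
    (hq : ∀ i, 0 < i → q ^ i ≠ 1) (k : ℕ) :
    ∑ i ∈ range (k + 1), qWeight q i * (symFactorial q a i + symFactorial q (a * q ^ 4) i) =
      symFactorial q (a * q ^ 2) k * qShiftedFactorial (-1) (q ^ 4) (k + 1) /
        qShiftedFactorial (q ^ 2) (q ^ 2) (2 * k) := by
  induction k with
  | zero => simp [qWeight, qShiftedFactorial_succ]
  | succ k ih =>
    rw [sum_range_succ, ih]
    have h1 := symFactorial_succ_eq_shift hq0 ha k
    have h2 := symFactorial_succ_eq_shift' hq0 ha k
    have hD : qShiftedFactorial (q ^ 2) (q ^ 2) (2 * k) ≠ 0 :=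
      qShiftedFactorial_self_ne_zero
        (fun i hi => by rw [← pow_mul]; exact hq _ (by omega)) _
    have hu : (1 - q ^ 2 * (q ^ 2) ^ (2 * k)) ≠ 0 := by
      rw [← pow_succ', ← pow_mul]
      exact sub_ne_zero.2 (hq _ (by omega)).symm
    have hv : (1 - q ^ 2 * (q ^ 2) ^ (2 * k + 1)) ≠ 0 := by
      rw [← pow_succ', ← pow_mul]
      exact sub_ne_zero.2 (hq _ (by omega)).symm
    rw [qWeight, show 2 * (k + 1) = 2 * k + 1 + 1 by ring,
      qShiftedFactorial_succ _ _ (2 * k + 1), qShiftedFactorial_succ _ _ (2 * k),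
      qShiftedFactorial_succ _ _ (k + 1), symFactorial_succ q (a * q ^ 2) k]
    generalize symFactorial q (a * q ^ 2) k = B at *
    generalize qShiftedFactorial (q ^ 2) (q ^ 2) (2 * k) = D at *
    generalize qShiftedFactorial (-1) (q ^ 4) (k + 1) = E at *
    have e1 : symFactorial q a (k + 1) =
        -((q * a - q ^ (2 * k)) * (q * a - q ^ (2 * k + 2))) * B / (q * a) := by
      rw [← h1]; field_simp
    have e2 : symFactorial q (a * q ^ 4) (k + 1) =
        -((1 - a * q ^ (2 * k + 3)) * (1 - a * q ^ (2 * k + 5))) * B / (q ^ 3 * a) := by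
      rw [← h2]; field_simp
    rw [e1, e2]
    simp only [← pow_mul] at hu hv ⊢
    have p1 : q ^ (2 * (2 * k)) = (q ^ (2 * k)) ^ 2 := by ring
    have p2 : q ^ (2 * (2 * k + 1)) = (q ^ (2 * k)) ^ 2 * q ^ 2 := by ring
    have p3 : q ^ (4 * (k + 1)) = (q ^ (2 * k)) ^ 2 * q ^ 4 := by ring
    simp only [p1, p2, p3, pow_add] at hu hv ⊢
    generalize q ^ (2 * k) = u at *
    rw [show q ^ 2 * (u ^ 2 * q ^ 2) = q ^ 4 * u ^ 2 by ring] at hv ⊢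
    obtain ⟨U, hU⟩ : ∃ U, U = 1 - q ^ 2 * u ^ 2 := ⟨_, rfl⟩
    obtain ⟨V, hV⟩ : ∃ V, V = 1 - q ^ 4 * u ^ 2 := ⟨_, rfl⟩
    rw [← hU] at hu ⊢
    rw [← hV] at hv ⊢
    field_simp
    rw [hU, hV]
    ring

theorem symFactorial_eq_zero {q : K} (hq0 : q ≠ 0) {N k : ℕ} (h : N < k) :
    symFactorial q (q ^ (2 * N + 1)) k = 0 := by
  refine prod_eq_zero (mem_range.2 h) ?_
  rw [div_self (pow_ne_zero _ hq0)]
  ring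

theorem sum_qWeight_mul_symFactorial_trunc {q : K} (hq0 : q ≠ 0) {N k : ℕ} (h : N ≤ k) :
    ∑ i ∈ range (k + 1), qWeight q i * symFactorial q (q ^ (2 * N + 1)) i =
      ∑ i ∈ range (N + 1), qWeight q i * symFactorial q (q ^ (2 * N + 1)) i := by
  symm
  refine sum_subset (range_subset_range.2 (by omega)) fun i _ hi => ?_
  rw [symFactorial_eq_zero hq0 (by simpa using hi), mul_zero]

theorem jacobiSym_two_add_four {b : ℕ} (hb : Odd b) :
    jacobiSym 2 (b + 4) = -jacobiSym 2 b := by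
  rw [jacobiSym.at_two hb, jacobiSym.at_two (hb.add_even (by decide))]
  push_cast
  obtain ⟨c, rfl⟩ := hb
  push_cast
  generalize (c : ZMod 8) = x
  revert x
  decide

/-- The step `a ↦ aq⁴` raises `2N+1` by `4`. The telescoped right side vanishes at the midpoint
`q^(2N+3)`, so the value changes sign, exactly as the Jacobi symbol does. -/
theorem sum_qWeight_mul_symFactorial {q : K} (hq0 : q ≠ 0) (hq : ∀ i, 0 < i → q ^ i ≠ 1) :
    ∀ {N k : ℕ}, N ≤ k →
      ∑ i ∈ range (k + 1), qWeight q i * symFactorial q (q ^ (2 * N + 1)) i =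
        (jacobiSym 2 (2 * N + 1) : K)
  | 0, k, h => by
    rw [sum_qWeight_mul_symFactorial_trunc hq0 h]
    simp [qWeight]
  | 1, k, h => by
    have h2 : (1 : K) - q ^ 2 ≠ 0 := sub_ne_zero.2 (hq 2 (by omega)).symm
    have h4 : (1 : K) - q ^ 4 ≠ 0 := sub_ne_zero.2 (hq 4 (by omega)).symm
    have e4 : q ^ 2 * q ^ 2 = q ^ 4 := by ring
    have hJ : jacobiSym 2 (2 * 1 + 1) = -1 := by
      rw [jacobiSym.at_two (by decide)]; decide
    rw [sum_qWeight_mul_symFactorial_trunc hq0 h, hJ]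
    simp only [qWeight, symFactorial, qShiftedFactorial, sum_range_succ, prod_range_succ,
      sum_range_zero, prod_range_zero]
    simp [e4]
    field_simp
    ring
  | N + 2, k, h => by
    have ih := sum_qWeight_mul_symFactorial hq0 hq (N := N) (k := k) (by omega)
    have hs := sum_qWeight_mul_symFactorial_add hq0 (pow_ne_zero (2 * N + 1) hq0) hq k
    rw [← pow_add, ← pow_add, show 2 * N + 1 + 2 = 2 * (N + 1) + 1 by ring,
      symFactorial_eq_zero hq0 (show N + 1 < k by omega)] at hs
    simp only [mul_add, sum_add_distrib] at hs
    rw [show 2 * (N + 2) + 1 = 2 * N + 1 + 4 by ring,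
      jacobiSym_two_add_four (odd_two_mul_add_one N)]
    rw [ih] at hs
    push_cast
    linear_combination hs

theorem qShiftedFactorial_sq_sq (q : K) (k : ℕ) :
    qShiftedFactorial (q ^ 2) (q ^ 2) (2 * k) =
      qShiftedFactorial q (q ^ 2) k * qShiftedFactorial (-q) (q ^ 2) k *
        qShiftedFactorial (q ^ 4) (q ^ 4) k := by
  induction k with
  | zero => simp
  | succ k ih =>
    rw [show 2 * (k + 1) = 2 * k + 1 + 1 by ring]
    simp only [qShiftedFactorial_succ, ih]
    ring

theorem qSum_eq_sum_qWeight {q : K} (hq : ∀ i, 0 < i → q ^ i ≠ 1) (k : ℕ) :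
    qSum q k = ∑ i ∈ range (k + 1), qWeight q i * qShiftedFactorial q (q ^ 2) i ^ 2 := by
  refine sum_congr rfl fun i _ => ?_
  have hD : qShiftedFactorial (q ^ 2) (q ^ 2) (2 * i) ≠ 0 :=
    qShiftedFactorial_self_ne_zero
      (fun i hi => by rw [← pow_mul]; exact hq _ (by omega)) _
  rw [qWeight]
  rw [qShiftedFactorial_sq_sq] at hD ⊢
  have h1 := left_ne_zero_of_mul (left_ne_zero_of_mul hD)
  have h2 := right_ne_zero_of_mul (left_ne_zero_of_mul hD)
  have h3 := right_ne_zero_of_mul hD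
  field_simp

/-- The deformation of `qSum q k`, as a polynomial in `a + a⁻¹`. -/
noncomputable def qSumPoly (q : K) (k : ℕ) : Polynomial K :=
  ∑ i ∈ range (k + 1), Polynomial.C (qWeight q i) * ∏ j ∈ range i,
    (Polynomial.C (1 + q ^ (4 * j + 2)) - Polynomial.C (q ^ (2 * j + 1)) * Polynomial.X)

theorem eval_qSumPoly (q : K) {a : K} (ha : a ≠ 0) (k : ℕ) :
    (qSumPoly q k).eval (a + a⁻¹) = ∑ i ∈ range (k + 1), qWeight q i * symFactorial q a i := by
  simp only [qSumPoly, Polynomial.eval_finsetSum, Polynomial.eval_mul, Polynomial.eval_C,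
    Polynomial.eval_prod, Polynomial.eval_sub, Polynomial.eval_X]
  refine sum_congr rfl fun i _ => ?_
  congr 1
  refine prod_congr rfl fun j _ => ?_
  field_simp
  ring

theorem eval_two_qSumPoly {q : K} (hq : ∀ i, 0 < i → q ^ i ≠ 1) (k : ℕ) :
    (qSumPoly q k).eval 2 = qSum q k := by
  have h := eval_qSumPoly q (one_ne_zero (α := K)) k
  rw [inv_one, one_add_one_eq_two] at h
  simp only [h, qSum_eq_sum_qWeight hq, symFactorial_one]

end Identity

/-! ### Valuations at a cyclotomic factor -/

section Local

variable {K : Type*} [Field K]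

/-- The subring `O` of `K` contains `q` as a unit, `1 - q ^ i` is an associate of `π` if `n ∣ i`
(for `i ≠ 0`), and it is a unit of `O` otherwise. -/
structure IsQLocal (O : Subring K) (π q : K) (n : ℕ) : Prop where
  pi_ne : π ≠ 0
  pi_mem : π ∈ O
  q_ne : q ≠ 0
  q_mem : q ∈ O
  q_inv_mem : q⁻¹ ∈ O
  pow_ne : ∀ i, 0 < i → q ^ i ≠ 1
  div_mem : ∀ i, n ∣ i → (1 - q ^ i) / π ∈ O
  pi_div_mem : ∀ i, 0 < i → n ∣ i → π / (1 - q ^ i) ∈ O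
  inv_mem : ∀ i, ¬ n ∣ i → (1 - q ^ i)⁻¹ ∈ O

theorem qShiftedFactorial_mem {O : Subring K} {a q : K} (ha : a ∈ O) (hq : q ∈ O) (k : ℕ) :
    qShiftedFactorial a q k ∈ O :=
  prod_mem fun _ _ => O.sub_mem O.one_mem (O.mul_mem ha (O.pow_mem hq _))

theorem Subring.div_pow_mem_of_le {O : Subring K} {π x : K} (h0 : π ≠ 0) (hπ : π ∈ O) {a b : ℕ}
    (hab : a ≤ b) (hx : x / π ^ b ∈ O) : x / π ^ a ∈ O := by
  obtain ⟨c, rfl⟩ := Nat.exists_eq_add_of_le hab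
  have : x / π ^ a = x / π ^ (a + c) * π ^ c := by
    rw [pow_add]; field_simp
  rw [this]
  exact O.mul_mem hx (O.pow_mem hπ _)

namespace IsQLocal

variable {O : Subring K} {π q : K} {n : ℕ}

theorem pow (h : IsQLocal O π q n) {c n' : ℕ} (hc : 0 < c)
    (hn : ∀ i, n ∣ c * i ↔ n' ∣ i) : IsQLocal O π (q ^ c) n' where
  pi_ne := h.pi_ne
  pi_mem := h.pi_mem
  q_ne := pow_ne_zero _ h.q_ne
  q_mem := O.pow_mem h.q_mem _
  q_inv_mem := by rw [← inv_pow]; exact O.pow_mem h.q_inv_mem _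
  pow_ne i hi := by rw [← pow_mul]; exact h.pow_ne _ (by positivity)
  div_mem i hi := by rw [← pow_mul]; exact h.div_mem _ ((hn i).2 hi)
  pi_div_mem i hi hi' := by
    rw [← pow_mul]; exact h.pi_div_mem _ (by positivity) ((hn i).2 hi')
  inv_mem i hi := by rw [← pow_mul]; exact h.inv_mem _ (mt (hn i).1 hi)

theorem one_sub_ne_zero (h : IsQLocal O π q n) {i : ℕ} (hi : 0 < i) : 1 - q ^ i ≠ 0 :=
  sub_ne_zero.2 (h.pow_ne i hi).symm

theorem one_sub_mem (h : IsQLocal O π q n) (i : ℕ) : 1 - q ^ i ∈ O :=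
  O.sub_mem O.one_mem (O.pow_mem h.q_mem _)

theorem pow_div_qShiftedFactorial_mem (h : IsQLocal O π q n) (k : ℕ) :
    π ^ (k / n) / qShiftedFactorial q q k ∈ O := by
  induction k with
  | zero => simp
  | succ k ih =>
    rw [qShiftedFactorial_succ, Nat.succ_div, ← pow_succ']
    split_ifs with hd
    · rw [pow_succ π, mul_div_mul_comm]
      exact O.mul_mem ih (h.pi_div_mem _ k.succ_pos hd)
    · rw [add_zero, div_mul_eq_div_mul_one_div, one_div]
      exact O.mul_mem ih (h.inv_mem _ hd)

theorem qShiftedFactorial_div_pow_mem (h : IsQLocal O π q n) (k : ℕ) :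
    qShiftedFactorial q q k / π ^ (k / n) ∈ O := by
  induction k with
  | zero => simp
  | succ k ih =>
    rw [qShiftedFactorial_succ, Nat.succ_div, ← pow_succ']
    split_ifs with hd
    · rw [pow_succ π, mul_div_mul_comm]
      exact O.mul_mem ih (h.div_mem _ hd)
    · rw [add_zero, mul_div_right_comm]
      exact O.mul_mem ih (h.one_sub_mem _)

/-- Since `2(k+r+1) = (2k+1) + (2r+1)`, the exponent counts the multiples of `2r+1` among `1, 3, …,
2k-1`. -/
theorem qShiftedFactorial_sq_div_pow_mem {r : ℕ} (h : IsQLocal O π q (2 * r + 1)) (k : ℕ) :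
    qShiftedFactorial q (q ^ 2) k / π ^ ((k + r) / (2 * r + 1)) ∈ O := by
  induction k with
  | zero =>
    rw [Nat.div_eq_of_lt (by omega)]
    simp
  | succ k ih =>
    rw [qShiftedFactorial_succ, add_right_comm, Nat.succ_div, ← pow_mul, ← pow_succ' q]
    split_ifs with hd
    · rw [pow_succ π, mul_div_mul_comm]
      refine O.mul_mem ih (h.div_mem _ ?_)
      have := Nat.dvd_sub (hd.mul_left 2) (dvd_refl (2 * r + 1))
      rwa [show 2 * (k + r + 1) - (2 * r + 1) = 2 * k + 1 by omega] at this
    · rw [add_zero, mul_div_right_comm]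
      exact O.mul_mem ih (h.one_sub_mem _)

theorem pow_mul_qWeight_mem (h : IsQLocal O π q n) (hn : Odd n) (k : ℕ) :
    π ^ (2 * k / n) * qWeight q k ∈ O := by
  have h2 : IsQLocal O π (q ^ 2) n :=
    h.pow two_pos fun i => (Nat.coprime_two_right.2 hn).dvd_mul_left
  have := h2.pow_div_qShiftedFactorial_mem (2 * k)
  rw [qWeight, ← mul_div_assoc, mul_div_right_comm]
  exact O.mul_mem this (O.mul_mem
    (qShiftedFactorial_mem (O.neg_mem O.one_mem) (O.pow_mem h.q_mem _) _) (O.pow_mem h.q_mem _))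

/-- With `b = ⌊2k/n⌋`, the weight costs `π^b` and the square gains at least `π^(2⌊(b+1)/2⌋)`; the
surplus is the parity of `b`. -/
theorem qSum_summand_div_pow_mem (h : IsQLocal O π q n) (hn : Odd n) (k : ℕ) :
    qWeight q k * qShiftedFactorial q (q ^ 2) k ^ 2 / π ^ (2 * k / n % 2) ∈ O := by
  have hw := h.pow_mul_qWeight_mem hn k
  obtain ⟨r, rfl⟩ := hn
  have hs := h.qShiftedFactorial_sq_div_pow_mem k
  have hle : 2 * k / (2 * r + 1) + 2 * k / (2 * r + 1) % 2 ≤ 2 * ((k + r) / (2 * r + 1)) := by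
    have hb := Nat.div_mul_le_self (2 * k) (2 * r + 1)
    have hc : (2 * k / (2 * r + 1) + 1) / 2 ≤ (k + r) / (2 * r + 1) := by
      rw [Nat.le_div_iff_mul_le (by omega)]
      generalize 2 * k / (2 * r + 1) = b at *
      obtain ⟨c, rfl | rfl⟩ := Nat.even_or_odd' b
      · rw [show (2 * c + 1) / 2 = c by omega]
        have : c * (2 * r + 1) ≤ k := by nlinarith
        omega
      · rw [show (2 * c + 1 + 1) / 2 = c + 1 by omega]
        by_contra! hlt
        have : 2 * (k + r) + 2 ≤ 2 * ((c + 1) * (2 * r + 1)) := by omega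
        nlinarith
    omega
  refine Subring.div_pow_mem_of_le (b := 2 * ((k + r) / (2 * r + 1)) - 2 * k / (2 * r + 1))
    h.pi_ne h.pi_mem (by omega) ?_
  convert O.mul_mem hw (O.pow_mem hs 2) using 1
  have hπ := h.pi_ne
  rw [pow_sub₀ _ hπ (by omega), div_pow, ← pow_mul, mul_comm ((k + r) / _) 2]
  field_simp

theorem qSum_mem (h : IsQLocal O π q n) (hn : Odd n) (k : ℕ) : qSum q k ∈ O := by
  rw [qSum_eq_sum_qWeight h.pow_ne]
  refine sum_mem fun i _ => ?_
  simpa using Subring.div_pow_mem_of_le h.pi_ne h.pi_mem (Nat.zero_le _)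
    (h.qSum_summand_div_pow_mem hn i)

/-- Every extra summand has `⌊2i/n⌋ = a`, which is odd, so each is divisible by `π`. -/
theorem qSum_sub_qSum_div_mem (h : IsQLocal O π q n) (hn : Odd n) {a k l : ℕ} (ha : Odd a)
    (hkl : k ≤ l) (hk : a * n ≤ 2 * k + 1) (hl : 2 * l < (a + 1) * n) :
    (qSum q l - qSum q k) / π ∈ O := by
  rw [qSum_eq_sum_qWeight h.pow_ne, qSum_eq_sum_qWeight h.pow_ne,
    ← sum_Ico_eq_sub _ (by omega : k + 1 ≤ l + 1), sum_div]
  refine sum_mem fun i hi => ?_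
  rw [mem_Ico] at hi
  have := h.qSum_summand_div_pow_mem hn i
  rwa [Nat.div_eq_of_lt_le (by omega) (by omega : 2 * i < (a + 1) * n),
    Nat.odd_iff.1 ha, pow_one] at this

theorem qSumPoly_mem_lifts (h : IsQLocal O π q n) (hn : Odd n) {k s : ℕ} (hs : 2 * k / n ≤ s) :
    Polynomial.C (π ^ s) * qSumPoly q k ∈ Polynomial.lifts O.subtype := by
  have hC : ∀ x ∈ O, Polynomial.C x ∈ Polynomial.lifts O.subtype := fun x hx =>
    Polynomial.C_mem_lifts O.subtype ⟨x, hx⟩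
  have hq : ∀ i, Polynomial.C (q ^ i) ∈ Polynomial.lifts O.subtype := fun i =>
    hC _ (O.pow_mem h.q_mem _)
  rw [qSumPoly, mul_sum]
  refine sum_mem fun i hi => ?_
  rw [← mul_assoc, ← Polynomial.C_mul]
  refine mul_mem (hC _ ?_) (prod_mem fun j _ => ?_)
  · obtain ⟨c, rfl⟩ := Nat.exists_eq_add_of_le
      ((Nat.div_le_div_right (by have := mem_range.1 hi; omega : 2 * i ≤ 2 * k)).trans hs)
    rw [pow_add, mul_right_comm]
    exact O.mul_mem (h.pow_mul_qWeight_mem hn i) (O.pow_mem h.pi_mem _)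
  · rw [sub_eq_add_neg, ← neg_mul, ← Polynomial.C_neg]
    exact add_mem (hC _ (O.add_mem O.one_mem (O.pow_mem h.q_mem _)))
      (mul_mem (hC _ (O.neg_mem (O.pow_mem h.q_mem _))) (Polynomial.X_mem_lifts _))

end IsQLocal

/-! ### Divisibility from many roots -/

theorem Polynomial.prod_sub_dvd_eval {R : Type*} [CommRing R] [IsDomain R] [DecidableEq R]
    (P : Polynomial R) (S : Finset R) (hS : ∀ x ∈ S, P.eval x = 0) (b : R) :
    ∏ x ∈ S, (b - x) ∣ P.eval b := by
  rcases eq_or_ne P 0 with rfl | hP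
  · simp
  have h : (S.val.map fun x => X - C x).prod ∣ P := by
    rw [Multiset.prod_X_sub_C_dvd_iff_le_roots hP, Multiset.le_iff_subset S.nodup]
    exact fun x hx => (mem_roots hP).2 (hS x hx)
  have h' := eval_dvd (x := b) h
  rwa [show (S.val.map fun x => X - C x).prod = ∏ x ∈ S, (X - C x) from rfl, eval_prod,
    Finset.prod_congr rfl fun x _ => show (X - C x).eval b = b - x by simp] at h'

/-- The cleared polynomial and its roots live over `O`, so the quotient by `∏ (b - x)` stays in `O`,
and each root contributes a factor `ρ`. -/
theorem Polynomial.eval_mul_pow_div_pow_mem {O : Subring K} {π ρ b : K} (hb : b ∈ O)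
    {P : Polynomial K} {s : ℕ} (hP : C (π ^ s) * P ∈ lifts O.subtype) (S : Finset K)
    (hS : ∀ x ∈ S, x ∈ O ∧ (b - x) / ρ ∈ O ∧ P.eval x = 0) :
    π ^ s * P.eval b / ρ ^ S.card ∈ O := by
  classical
  obtain ⟨P', hP'⟩ := (mem_lifts _).1 hP
  have hev : ∀ y : O, ((P'.eval y : O) : K) = π ^ s * P.eval (y : K) := fun y => by
    have := congrArg (Polynomial.eval (y : K)) hP'
    rw [eval_mul, eval_C] at this
    rw [← this, eval_map]
    exact (eval₂_at_apply O.subtype y).symm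
  obtain ⟨c, hc⟩ := P'.prod_sub_dvd_eval (S.subtype (· ∈ O)) (fun y hy => by
    ext
    rw [hev, (hS y (mem_subtype.1 hy)).2.2, mul_zero, ZeroMemClass.coe_zero]) ⟨b, hb⟩
  have hc' := congrArg (O.subtype) hc
  rw [map_mul, map_prod, Subring.subtype_apply, hev] at hc'
  simp only [Subring.subtype_apply, AddSubgroupClass.coe_sub] at hc'
  rw [hc', prod_subtype_of_mem (fun x => b - x) (p := (· ∈ O)) (fun x hx => (hS x hx).1),
    mul_div_right_comm, ← prod_const, ← prod_div_distrib]
  exact O.mul_mem (prod_mem fun x hx => (hS x hx).2.1) c.2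

theorem add_inv_pow_injective {q : K} (hq0 : q ≠ 0) (hq : ∀ i, 0 < i → q ^ i ≠ 1) {a b : ℕ}
    (h : q ^ a + (q ^ a)⁻¹ = q ^ b + (q ^ b)⁻¹) : a = b := by
  wlog hab : a < b generalizing a b
  · rcases (not_lt.1 hab).eq_or_lt with h' | h'
    · exact h'.symm
    · exact (this h.symm h').symm
  obtain ⟨c, rfl⟩ := Nat.exists_eq_add_of_lt hab
  exfalso
  have ha := pow_ne_zero a hq0
  have hc := pow_ne_zero (c + 1) hq0
  have h1 : (1 - q ^ (c + 1)) * (1 - q ^ (2 * a + c + 1)) = 0 := by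
    rw [add_assoc a, pow_add q a] at h
    rw [show 2 * a + c + 1 = a + a + (c + 1) by ring, pow_add _ (a + a), pow_add _ a]
    generalize q ^ a = A at *
    generalize q ^ (c + 1) = B at *
    field_simp at h
    linear_combination -h
  rcases mul_eq_zero.1 h1 with h2 | h2
  · exact hq _ c.succ_pos (sub_eq_zero.1 h2).symm
  · exact hq _ (by omega) (sub_eq_zero.1 h2).symm

theorem IsQLocal.qSum_sub_div_sq_mem {O : Subring K} {π q : K} {n m : ℕ} (h : IsQLocal O π q n)
    (hn : Odd n) (hm : Odd m) :
    (qSum q ((m * n - 1) / 2) - (jacobiSym 2 n : K) * qSum (q ^ n) ((m - 1) / 2)) / π ^ 2 ∈ O := by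
  classical
  have h' : IsQLocal O π (q ^ n) 1 := h.pow hn.pos fun i => by simp
  obtain ⟨r, rfl⟩ := hm
  have hmn : Odd ((2 * r + 1) * n) := (odd_two_mul_add_one r).mul hn
  set k := ((2 * r + 1) * n - 1) / 2 with hk
  have hk' : 2 * k + 1 = (2 * r + 1) * n := by obtain ⟨c, hc⟩ := hmn; omega
  rw [show (2 * r + 1 - 1) / 2 = r by omega]
  set x : ℕ → K := fun j => q ^ ((2 * j + 1) * n) + (q ^ ((2 * j + 1) * n))⁻¹ with hx
  have hP : Polynomial.C (π ^ (2 * r)) *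
      (qSumPoly q k - Polynomial.C (jacobiSym 2 n : K) * qSumPoly (q ^ n) r) ∈
        Polynomial.lifts O.subtype := by
    rw [mul_sub, mul_left_comm, sub_eq_add_neg, ← neg_mul, ← Polynomial.C_neg]
    refine add_mem (h.qSumPoly_mem_lifts hn ?_) (mul_mem
      (Polynomial.C_mem_lifts O.subtype ⟨_, O.neg_mem (intCast_mem O _)⟩)
      (h'.qSumPoly_mem_lifts odd_one (by simp)))
    -- `2k = (2r+1)n - 1`, hence `⌊2k/n⌋ ≤ 2r`.
    refine Nat.le_of_lt_succ ((Nat.div_lt_iff_lt_mul hn.pos).2 ?_)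
    rw [Nat.succ_eq_add_one]
    omega
  have key := Polynomial.eval_mul_pow_div_pow_mem (ρ := π ^ 2)
    (by exact_mod_cast intCast_mem O 2 : (2 : K) ∈ O) hP ((range (r + 1)).image x) (by
      intro y hy
      obtain ⟨j, hj, rfl⟩ := mem_image.1 hy
      rw [mem_range] at hj
      have hq := pow_ne_zero ((2 * j + 1) * n) h.q_ne
      refine ⟨O.add_mem (O.pow_mem h.q_mem _) ?_, ?_, ?_⟩
      · rw [← inv_pow]
        exact O.pow_mem h.q_inv_mem _
      -- With `Q = q^((2j+1)n)`, `2 - Q - Q⁻¹ = -(1-Q)²/Q`: a double zero at `Q = 1`.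
      · have : (2 - x j) / π ^ 2 =
            -(((1 - q ^ ((2 * j + 1) * n)) / π) ^ 2 * q⁻¹ ^ ((2 * j + 1) * n)) := by
          have hπ := h.pi_ne
          simp only [hx, inv_pow]
          field_simp
          ring
        rw [this]
        exact O.neg_mem (O.mul_mem (O.pow_mem (h.div_mem _ (dvd_mul_left _ _)) 2)
          (O.pow_mem h.q_inv_mem _))
      · have hjn : Odd ((2 * j + 1) * n) := (odd_two_mul_add_one j).mul hn
        obtain ⟨l, hl⟩ := hjn
        have hlk : l ≤ k := by
          have : (2 * j + 1) * n ≤ (2 * r + 1) * n := Nat.mul_le_mul_right _ (by omega)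
          omega
        have : NeZero n := ⟨hn.pos.ne'⟩
        rw [Polynomial.eval_sub, Polynomial.eval_mul, Polynomial.eval_C, hx]
        dsimp only
        rw [eval_qSumPoly _ hq, hl, sum_qWeight_mul_symFactorial h.q_ne h.pow_ne hlk, ← hl,
          mul_comm _ n, pow_mul, eval_qSumPoly _ (pow_ne_zero _ (pow_ne_zero _ h.q_ne)),
          sum_qWeight_mul_symFactorial h'.q_ne h'.pow_ne (by omega : j ≤ r),
          jacobiSym.mul_right]
        push_cast
        ring)
  have hcard : ((range (r + 1)).image x).card = r + 1 := by
    rw [card_image_of_injective, card_range]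
    intro i j hij
    have := Nat.eq_of_mul_eq_mul_right hn.pos (add_inv_pow_injective h.q_ne h.pow_ne hij)
    omega
  rw [hcard, Polynomial.eval_sub, Polynomial.eval_mul, Polynomial.eval_C,
    eval_two_qSumPoly h.pow_ne, eval_two_qSumPoly h'.pow_ne, ← pow_mul,
    show 2 * (r + 1) = 2 * r + 2 by ring, pow_add,
    mul_div_mul_left _ _ (pow_ne_zero _ h.pi_ne)] at key
  exact key

/-! ### The prefactor and the full quotient -/

theorem qInteger_mul_one_sub {R : Type*} [CommRing R] (q : R) (n : ℕ) :
    qInteger q n * (1 - q) = 1 - q ^ n :=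
  geom_sum_mul_neg q n

namespace IsQLocal

variable {O : Subring K} {π q : K}

theorem pow_div_qBinomial_mem {n : ℕ} (h : IsQLocal O π q n) (k : ℕ) :
    π ^ (2 * k / n - 2 * (k / n)) / qBinomial q (2 * k) k ∈ O := by
  have h1 := h.pow_div_qShiftedFactorial_mem (2 * k)
  have h2 := O.pow_mem (h.qShiftedFactorial_div_pow_mem k) 2
  have hle : 2 * (k / n) ≤ 2 * k / n := Nat.mul_div_le_mul_div_assoc _ _ _
  rw [qBinomial, if_pos (by omega), show 2 * k - k = k by omega, pow_sub₀ _ h.pi_ne hle]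
  convert O.mul_mem h1 h2 using 1
  have hk := qShiftedFactorial_self_ne_zero h.pow_ne k
  have hk' := qShiftedFactorial_self_ne_zero h.pow_ne (2 * k)
  have hπ := h.pi_ne
  rw [div_pow, ← pow_mul, mul_comm (k / n) 2]
  field_simp

theorem inv_qInteger_eq {n m : ℕ} (h : IsQLocal O π q n) :
    (qInteger q m)⁻¹ = (1 - q) / (1 - q ^ m) := by
  have h1 : 1 - q ≠ 0 := by simpa using h.one_sub_ne_zero one_pos
  rw [← qInteger_mul_one_sub, div_mul_cancel_right₀ h1]

theorem inv_qInteger_mem {n m : ℕ} (h : IsQLocal O π q n) (hm : ¬ n ∣ m) :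
    (qInteger q m)⁻¹ ∈ O := by
  rw [h.inv_qInteger_eq, div_eq_mul_inv]
  exact O.mul_mem (by simpa using h.one_sub_mem 1) (h.inv_mem m hm)

theorem pi_div_qInteger_mem {n m : ℕ} (h : IsQLocal O π q n) (hm0 : 0 < m) (hm : n ∣ m) :
    π / qInteger q m ∈ O := by
  rw [div_eq_mul_inv, h.inv_qInteger_eq, mul_div_left_comm]
  exact O.mul_mem (by simpa using h.one_sub_mem 1) (h.pi_div_mem m hm0 hm)

theorem inv_qInteger_mem_of_one {m : ℕ} (h : IsQLocal O π q 1) (hm : 0 < m) :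
    (qInteger q m)⁻¹ ∈ O := by
  have : (qInteger q m)⁻¹ = (1 - q ^ 1) / π * (π / (1 - q ^ m)) := by
    rw [h.inv_qInteger_eq, pow_one, div_mul_div_cancel₀ h.pi_ne]
  rw [this]
  exact O.mul_mem (h.div_mem 1 (one_dvd _)) (h.pi_div_mem m hm (one_dvd _))

/-- Every `1 - q^(ni)` with `i > 0` is an associate of `π`; these factors cancel in the prefactor,
leaving it in `O`. -/
theorem quotient_div_sq_mem {n m : ℕ} (h : IsQLocal O π q n) (hn : Odd n) (hm : Odd m) :
    (1 / (qInteger (q ^ n) m ^ 2 * qBinomial (q ^ n) (m - 1) ((m - 1) / 2)) *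
      (qSum q ((m * n - 1) / 2) - (jacobiSym 2 n : K) * qSum (q ^ n) ((m - 1) / 2))) / π ^ 2
      ∈ O := by
  have h' : IsQLocal O π (q ^ n) 1 := h.pow hn.pos fun i => by simp
  have hD := h.qSum_sub_div_sq_mem hn hm
  have hI := h'.inv_qInteger_mem_of_one hm.pos
  have hB := h'.pow_div_qBinomial_mem ((m - 1) / 2)
  rw [show 2 * ((m - 1) / 2) = m - 1 by obtain ⟨c, rfl⟩ := hm; omega, Nat.div_one, Nat.div_one,
    show m - 1 - 2 * ((m - 1) / 2) = 0 by obtain ⟨c, rfl⟩ := hm; omega, pow_zero] at hB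
  convert O.mul_mem (O.mul_mem (O.pow_mem hI 2) hB) hD using 1
  rw [one_div, mul_inv, inv_pow, one_div]
  ring

theorem quotient_mem {n N m : ℕ} (h : IsQLocal O π q (n * N)) (hn : Odd n) (hN : Odd N)
    (hm : Odd m) :
    1 / (qInteger (q ^ n) m ^ 2 * qBinomial (q ^ n) (m - 1) ((m - 1) / 2)) *
      (qSum q ((m * n - 1) / 2) - (jacobiSym 2 n : K) * qSum (q ^ n) ((m - 1) / 2)) ∈ O := by
  have h' : IsQLocal O π (q ^ n) N := h.pow hn.pos fun i => Nat.mul_dvd_mul_iff_left hn.pos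
  have hnN := hn.mul hN
  have hπ := h.pi_ne
  have : NeZero n := ⟨hn.pos.ne'⟩
  have : NeZero N := ⟨hN.pos.ne'⟩
  have hB := h'.pow_div_qBinomial_mem ((m - 1) / 2)
  have hm2 : 2 * ((m - 1) / 2) = m - 1 := by obtain ⟨c, rfl⟩ := hm; omega
  rw [hm2] at hB
  -- Both sums are compared with the sum in `q^(nN)`; `(2/nN) = (2/n)(2/N)` cancels it.
  have hcongr : ∀ a, Odd a → (qSum q ((a * (n * N) - 1) / 2) -
      (jacobiSym 2 n : K) * qSum (q ^ n) ((a * N - 1) / 2)) / π ^ 2 ∈ O := fun a ha => by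
    have h1 := h.qSum_sub_div_sq_mem hnN ha
    have h2 := O.mul_mem (intCast_mem O (jacobiSym 2 n)) (h'.qSum_sub_div_sq_mem hN ha)
    convert O.sub_mem h1 h2 using 1
    rw [jacobiSym.mul_right, ← pow_mul]
    push_cast
    ring
  by_cases hd : N ∣ m
  · obtain ⟨a, rfl⟩ := hd
    have ha : Odd a := (Nat.odd_mul.1 hm).2
    have hI := h'.pi_div_qInteger_mem hm.pos (dvd_mul_right N a)
    -- `⌊(Na-1)/N⌋ = a - 1` is even, so the binomial costs no `π`; only `[m]²` does.
    have he : (N * a - 1) / N - 2 * ((N * a - 1) / 2 / N) = 0 := by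
      obtain ⟨c, rfl⟩ := ha
      obtain ⟨d, rfl⟩ := hN
      have e1 : ((2 * d + 1) * (2 * c + 1) - 1) / (2 * d + 1) = 2 * c := by
        refine Nat.div_eq_of_lt_le ?_ ?_
        · rw [Nat.le_sub_iff_add_le hm.pos]
          nlinarith
        · have : 0 < (2 * d + 1) * (2 * c + 1) := by positivity
          have : (2 * d + 1) * (2 * c + 1) = (2 * c + 1) * (2 * d + 1) := mul_comm _ _
          omega
      rw [Nat.div_div_eq_div_mul, mul_comm 2 (2 * d + 1), ← Nat.div_div_eq_div_mul, e1]
      omega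
    rw [he, pow_zero] at hB
    have hD := hcongr a ha
    rw [← mul_assoc, mul_comm (a * n) N, ← mul_assoc, mul_comm a N] at hD
    convert O.mul_mem (O.mul_mem (O.pow_mem hI 2) hB) hD using 1
    field_simp
  · have hI := O.pow_mem (h'.inv_qInteger_mem hd) 2
    set a := (m - 1) / N with ha
    have hlt : a * N < m := by
      have h1 := Nat.div_mul_le_self (m - 1) N
      rw [← ha] at h1
      have h2 := hm.pos
      omega
    have hlt' : m < (a + 1) * N := by
      have h1 : m - 1 < (a + 1) * N := Nat.lt_mul_of_div_lt (by omega) hN.pos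
      have h2 : m ≠ (a + 1) * N := fun e => hd ⟨_, e.trans (mul_comm _ _)⟩
      omega
    have ha2 : (m - 1) / 2 / N = a / 2 := by
      rw [Nat.div_div_eq_div_mul, mul_comm 2 N, ← Nat.div_div_eq_div_mul]
    rw [ha2] at hB
    -- Here only the binomial can cost a `π`, and at most one, when `a` is odd. In that case,
    -- truncating at the multiples `a(nN)` and `aN` changes the sums by multiples of `π`, and
    -- `hcongr` applies.
    suffices hD : (qSum q ((m * n - 1) / 2) -
        (jacobiSym 2 n : K) * qSum (q ^ n) ((m - 1) / 2)) / π ^ (a - 2 * (a / 2)) ∈ O by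
      convert O.mul_mem (O.mul_mem hI hB) hD using 1
      field_simp
    have hmn := hm.mul hn
    rcases Nat.even_or_odd a with ha' | ha'
    · rw [show a - 2 * (a / 2) = 0 by obtain ⟨c, hc⟩ := ha'; omega, pow_zero, div_one]
      exact O.sub_mem (h.qSum_mem hnN _) (O.mul_mem (intCast_mem O _) (h'.qSum_mem hN _))
    · rw [show a - 2 * (a / 2) = 1 by obtain ⟨c, hc⟩ := ha'; omega, pow_one]
      have hc := O.mul_mem (hcongr a ha') h.pi_mem
      have hN' : Odd (a * N) := ha'.mul hN
      have hL' : Odd (a * (n * N)) := ha'.mul hnN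
      have hlL : a * (n * N) < m * n := by nlinarith [hn.pos]
      have hlL' : m * n < (a + 1) * (n * N) := by nlinarith [hn.pos]
      have h1 := h.qSum_sub_qSum_div_mem hnN ha' (k := (a * (n * N) - 1) / 2)
        (l := (m * n - 1) / 2) (by omega)
        (by obtain ⟨c, hc⟩ := hL'; omega) (by omega)
      have h2 := O.mul_mem (intCast_mem O (jacobiSym 2 n))
        (h'.qSum_sub_qSum_div_mem hN ha' (k := (a * N - 1) / 2)
          (l := (m - 1) / 2) (by omega) (by obtain ⟨c, hc⟩ := hN'; omega) (by omega))
      convert O.sub_mem (O.add_mem hc h1) h2 using 1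
      field_simp
      ring

end IsQLocal

end Local

/-! ### Specialization to rational functions and cyclotomic polynomials -/

/-- The rational functions whose reduced denominator is coprime to `P`. -/
def RatFunc.coprimeDenom {K : Type*} [Field K] (P : Polynomial K) : Subring (RatFunc K) where
  carrier := {f | IsCoprime f.denom P}
  mul_mem' {f g} hf hg := (hf.mul_left hg).of_isCoprime_of_dvd_left (f.denom_mul_dvd g)
  one_mem' := by simpa using isCoprime_one_left
  add_mem' {f g} hf hg := (hf.mul_left hg).of_isCoprime_of_dvd_left (f.denom_add_dvd g)
  zero_mem' := by simpa using isCoprime_one_left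
  neg_mem' {f} hf := by
    have : (-f).denom ∣ f.denom := by
      have := RatFunc.denom_mul_dvd (RatFunc.C (-1)) f
      rwa [RatFunc.denom_C, one_mul, map_neg, map_one, neg_one_mul] at this
    exact IsCoprime.of_isCoprime_of_dvd_left hf this

namespace RatFunc

variable {K : Type*} [Field K] {P : Polynomial K}

theorem div_mem_coprimeDenom (A : Polynomial K) {B : Polynomial K} (hB : IsCoprime B P) :
    algebraMap _ (RatFunc K) A / algebraMap _ _ B ∈ coprimeDenom P := by
  exact hB.of_isCoprime_of_dvd_left (denom_div_dvd A B)

theorem ratFuncModEq_zero_of_div_mem (hP : P ≠ 0) {f : RatFunc K} {k : ℕ}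
    (hf : f / algebraMap _ _ P ^ k ∈ coprimeDenom P) : RatFuncModEq (P ^ k) f 0 := by
  have hP' : algebraMap _ (RatFunc K) P ≠ 0 := by simpa using hP
  have hPm : algebraMap _ (RatFunc K) P ∈ coprimeDenom P := by
    simpa using div_mem_coprimeDenom P isCoprime_one_left
  have hf' : IsCoprime f.denom P := by
    have := (coprimeDenom P).mul_mem hf ((coprimeDenom P).pow_mem hPm k)
    rwa [div_mul_cancel₀ _ (pow_ne_zero _ hP')] at this
  rw [RatFuncModEq, sub_zero]
  refine ⟨?_, hf'.pow_right⟩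
  set g := f / algebraMap _ _ P ^ k with hg
  have hfg : f = algebraMap _ _ P ^ k * g := by rw [hg]; field_simp
  have e : f.num * g.denom = P ^ k * (g.num * f.denom) := by
    refine algebraMap_injective K ?_
    have h1 : algebraMap _ (RatFunc K) f.denom ≠ 0 := by simpa using f.denom_ne_zero
    have h2 : algebraMap _ (RatFunc K) g.denom ≠ 0 := by simpa using g.denom_ne_zero
    have h3 := num_div_denom f
    have h4 := num_div_denom g
    rw [← h3, ← h4] at hfg
    simp only [map_mul, map_pow]
    field_simp at hfg
    linear_combination hfg
  exact (IsCoprime.pow_left (IsCoprime.symm hf)).dvd_of_dvd_mul_right (Dvd.intro _ e.symm)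

end RatFunc

open Polynomial in
-- `Φ_L` occurs once in `∏_{d ∣ i} Φ_d`, and distinct cyclotomic polynomials are coprime over `ℚ`.
theorem Polynomial.exists_X_pow_sub_one_eq_cyclotomic_mul {L i : ℕ} (hi : 0 < i) (h : L ∣ i) :
    ∃ B, X ^ i - 1 = cyclotomic L ℚ * B ∧ IsCoprime B (cyclotomic L ℚ) := by
  refine ⟨∏ d ∈ i.divisors.erase L, cyclotomic d ℚ, ?_, IsCoprime.prod_left fun d hd =>
    cyclotomic.isCoprime_rat (ne_of_mem_erase hd)⟩
  rw [mul_prod_erase _ (fun d => cyclotomic d ℚ) (Nat.mem_divisors.2 ⟨h, hi.ne'⟩),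
    prod_cyclotomic_eq_X_pow_sub_one hi]

open Polynomial in
theorem Polynomial.isCoprime_X_pow_sub_one_cyclotomic {L i : ℕ} (h : ¬ L ∣ i) :
    IsCoprime (X ^ i - 1) (cyclotomic L ℚ) := by
  have hi : 0 < i := Nat.pos_of_ne_zero fun e => h (e ▸ dvd_zero L)
  rw [← prod_cyclotomic_eq_X_pow_sub_one hi]
  exact IsCoprime.prod_left fun d hd =>
    cyclotomic.isCoprime_rat fun e => h (e ▸ Nat.dvd_of_mem_divisors hd)

theorem isQLocal_cyclotomic {L : ℕ} (hL : 0 < L) :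
    IsQLocal (RatFunc.coprimeDenom (Polynomial.cyclotomic L ℚ))
      (algebraMap _ (RatFunc ℚ) (Polynomial.cyclotomic L ℚ)) RatFunc.X L := by
  have hX : ∀ i : ℕ, (1 - RatFunc.X ^ i : RatFunc ℚ) =
      -algebraMap _ _ ((Polynomial.X : Polynomial ℚ) ^ i - 1) := fun i => by simp
  have hΦ : algebraMap _ (RatFunc ℚ) (Polynomial.cyclotomic L ℚ) ≠ 0 := by
    simpa using Polynomial.cyclotomic_ne_zero L ℚ
  have hmem : ∀ A : Polynomial ℚ, algebraMap _ (RatFunc ℚ) A ∈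
      RatFunc.coprimeDenom (Polynomial.cyclotomic L ℚ) := fun A => by
    simpa using RatFunc.div_mem_coprimeDenom A isCoprime_one_left
  refine ⟨hΦ, hmem _, RatFunc.X_ne_zero, by simpa using hmem Polynomial.X, ?_, ?_, ?_, ?_, ?_⟩
  · have : IsCoprime (Polynomial.X : Polynomial ℚ) (Polynomial.cyclotomic L ℚ) := by
      obtain ⟨B, hB, -⟩ := Polynomial.exists_X_pow_sub_one_eq_cyclotomic_mul hL dvd_rfl
      refine ⟨Polynomial.X ^ (L - 1), -B, ?_⟩
      rw [← pow_succ, Nat.sub_add_cancel hL]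
      linear_combination hB
    simpa using RatFunc.div_mem_coprimeDenom 1 this
  · intro i hi h
    have := hX i
    rw [h, sub_self, eq_comm, neg_eq_zero,
      map_eq_zero_iff _ (RatFunc.algebraMap_injective ℚ)] at this
    exact Polynomial.X_pow_sub_C_ne_zero hi (1 : ℚ) (by simpa using this)
  · intro i hi
    rcases i.eq_zero_or_pos with rfl | hi0
    · simp
    obtain ⟨B, hB, -⟩ := Polynomial.exists_X_pow_sub_one_eq_cyclotomic_mul hi0 hi
    rw [hX, hB, map_mul, neg_div, mul_div_cancel_left₀ _ hΦ]
    exact neg_mem (hmem _)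
  · intro i hi0 hi
    obtain ⟨B, hB, hc⟩ := Polynomial.exists_X_pow_sub_one_eq_cyclotomic_mul hi0 hi
    rw [hX, hB, map_mul, div_neg, div_mul_cancel_left₀ hΦ]
    simpa using neg_mem (RatFunc.div_mem_coprimeDenom 1 hc)
  · intro i hi
    rw [hX, inv_neg]
    simpa using RatFunc.div_mem_coprimeDenom 1
      (Polynomial.isCoprime_X_pow_sub_one_cyclotomic hi)

theorem theorem1p2 (m n : ℕ) (hm : Odd m) (hn : Odd n) (hn1 : 1 < n) :
    RatFuncModEq (Polynomial.cyclotomic n ℚ ^ 2) (sunQuotient m n) 0 ∧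
      ∀ j : ℕ, 2 ≤ j →
        IsCoprime (sunQuotient m n).denom (Polynomial.cyclotomic (n ^ j) ℚ) := by
  refine ⟨RatFunc.ratFuncModEq_zero_of_div_mem (Polynomial.cyclotomic_ne_zero n ℚ)
    ((isQLocal_cyclotomic hn.pos).quotient_div_sq_mem hn hm), fun j hj => ?_⟩
  obtain ⟨i, rfl⟩ : ∃ i, j = i + 1 := ⟨j - 1, by omega⟩
  have h := isQLocal_cyclotomic (pow_pos hn.pos (i + 1))
  -- Splits `n^j` as `n * N` with `N = n^(j-1)`.
  rw [pow_succ'] at h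
  rw [pow_succ']
  exact h.quotient_mem hn hn.pow hm
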